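/- Let $t\ge 1$ and $k\ge 2t$ be fixed integers. For a finite set $V$ with $|V|=v$, let $M$ be the $\binom{v}{t}\times\binom{v}{t}$ matrix whose rows and columns are indexed by the $t$-element subsets of $V$, with entries $M(T,U)=\binom{v-t-i}{k-t-i}$, where $i=|T\setminus U|$. All rows of $M$ have the same sum; let $M_1$ be the matrix obtained from $M$ by replacing its first column (for any chosen ordering of the $t$-subsets) by the constant vector of row sums of $M$. Then there are a real function $\theta_t=\theta_t(v)$ and an integer $v_0$, both depending only on $k$ and $t$, such that $$\theta_t(v)=\binom{v-t}{k-t}+o(v^{k-t})\qquad (v\to\infty),$$ and for every finite set $V$ with $v=|V|\ge v_0$ the least eigenvalue of $M$ is $\theta_t(v)$, and all (complex) eigenvalues of $M_1$ are real and at least $\tfrac12\theta_t(v)$. -/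

import Mathlib

open Filter Asymptotics

/-- The number `ξ_i = binom(v-t-i, k-t-i)`. All subtractions are genuine when
`2 * t ≤ k`, `i ≤ t` and `t + i ≤ v`, the only range in which it is used. -/
def xi (v k t i : ℕ) : ℕ := (v - t - i).choose (k - t - i)

/-- The matrix `M`, indexed by the `t`-element subsets of `V`, with entries
`M(T, U) = ξ_i` for `i = |T \ U|`. -/
def coverageMatrix (V : Type*) [Fintype V] [DecidableEq V] (k t : ℕ) :
    Matrix {T : Finset V // T.card = t} {T : Finset V // T.card = t} ℝ :=
  Matrix.of fun T U => (xi (Fintype.card V) k t (T.1 \ U.1).card : ℝ)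

/-- The matrix obtained from `M` by replacing the column indexed by `W` with the vector of row
sums of `M`. With `W` the first `t`-subset in the chosen ordering this is `M_1`. -/
def coverageMatrixReplaced (V : Type*) [Fintype V] [DecidableEq V] (k t : ℕ)
    (W : {T : Finset V // T.card = t}) :
    Matrix {T : Finset V // T.card = t} {T : Finset V // T.card = t} ℝ :=
  (coverageMatrix V k t).updateCol W fun T => ∑ U, coverageMatrix V k t T U

/-! Write `s = |T ∩ U|`. Vandermonde turns the entry `binom(v-2t+s, k-2t+s)` into `∑ j, binom(v-2t,
k-2t+j) * binom(s, j)`, so `M` is a nonnegative combination of Gram matrices of the inclusion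
matrices between `j`-subsets and `t`-subsets. The term `j = t` is a multiple of the identity, whence
`M ≥ θ = binom(v-2t, k-t)`. Equality holds on the kernel of the inclusion matrix for `j = t-1`,
which is nonzero by dimension and is killed by every lower one. Both `θ` and `binom(v-t, k-t)` are
asymptotic to `v^(k-t)/(k-t)!`.

For `M_1` only symmetry, constant row sums `r` and `θ ≤ M ≤ r` matter
(`eigenvalue_updateCol_rowSum`). An eigenvector nonzero at `W` yields a vector `w` orthogonal to
constants with `M w = z(w + d)`, where `d` is the projection of the basis vector at `W`. The bounds
`M² ≤ rM`, `M ≥ θ` and `|(M-θ)w|² ≥ 0` then confine `z`. -/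

/-! ### Replacing a column by the row sums in a matrix with `θ ≤ M ≤ r`. -/

open Matrix in
/-- Quadratic form data of a complex vector with respect to a real symmetric matrix `M` with
`θ ≤ M ≤ r`. -/
theorem exists_quadratic_data {n : Type*} [Fintype n] {M : Matrix n n ℝ} {θ r : ℝ}
    (hM : M.IsSymm) (hθ : 0 < θ) (hr : 0 < r)
    (hlow : ∀ x : n → ℝ, θ * (x ⬝ᵥ x) ≤ x ⬝ᵥ M *ᵥ x)
    (hupp : ∀ x : n → ℝ, x ⬝ᵥ M *ᵥ x ≤ r * (x ⬝ᵥ x)) (w : n → ℂ) :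
    ∃ s q S : ℝ, star w ⬝ᵥ w = s ∧ star w ⬝ᵥ M.map Complex.ofReal *ᵥ w = q ∧
      star (M.map Complex.ofReal *ᵥ w) ⬝ᵥ (M.map Complex.ofReal *ᵥ w) = S ∧
      0 ≤ s ∧ (s = 0 → w = 0) ∧ θ * s ≤ q ∧ S ≤ r * q ∧ 0 ≤ S - 2 * θ * q + θ ^ 2 * s := by
  have hsymm (x y : n → ℝ) : x ⬝ᵥ M *ᵥ y = (M *ᵥ x) ⬝ᵥ y := by
    rw [dotProduct_mulVec, ← mulVec_transpose, hM.eq]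
  have hself (x : n → ℝ) : 0 ≤ x ⬝ᵥ x := Finset.sum_nonneg fun i _ => mul_self_nonneg (x i)
  have hS (x : n → ℝ) : (M *ᵥ x) ⬝ᵥ (M *ᵥ x) ≤ r * (x ⬝ᵥ M *ᵥ x) := by
    have h1 := hupp (M *ᵥ x)
    -- Positivity of `M` at `(r - M)x`, with the upper bound at `Mx`, gives `M² ≤ rM`.
    have h2 : 0 ≤ (r • x - M *ᵥ x) ⬝ᵥ M *ᵥ (r • x - M *ᵥ x) :=
      le_trans (mul_nonneg hθ.le (hself _)) (hlow _)
    simp only [mulVec_sub, mulVec_smul, sub_dotProduct, dotProduct_sub, smul_dotProduct,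
      dotProduct_smul, smul_eq_mul] at h1 h2
    rw [hsymm x (M *ᵥ x)] at h2
    have : 0 ≤ r * (r * (x ⬝ᵥ M *ᵥ x) - (M *ᵥ x) ⬝ᵥ (M *ᵥ x)) := by linarith
    linarith [nonneg_of_mul_nonneg_right this hr]
  have hsq (x : n → ℝ) :
      0 ≤ (M *ᵥ x) ⬝ᵥ (M *ᵥ x) - 2 * θ * (x ⬝ᵥ M *ᵥ x) + θ ^ 2 * (x ⬝ᵥ x) := by
    have h := hself (M *ᵥ x - θ • x)
    simp only [sub_dotProduct, dotProduct_sub, smul_dotProduct, dotProduct_smul,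
      smul_eq_mul] at h
    rw [dotProduct_comm (M *ᵥ x) x] at h
    linarith
  have hdot (v u : n → ℂ) : star v ⬝ᵥ u =
      ((((fun i => (v i).re) ⬝ᵥ fun i => (u i).re) +
        ((fun i => (v i).im) ⬝ᵥ fun i => (u i).im) : ℝ) : ℂ) +
      ((((fun i => (v i).re) ⬝ᵥ fun i => (u i).im) -
        ((fun i => (v i).im) ⬝ᵥ fun i => (u i).re) : ℝ) : ℂ) * Complex.I := by
    apply Complex.ext <;>
      simp [dotProduct, Finset.sum_add_distrib, sub_eq_add_neg]
  set a : n → ℝ := fun i => (w i).re with ha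
  set b : n → ℝ := fun i => (w i).im with hb
  have hre : (fun i => ((M.map Complex.ofReal *ᵥ w) i).re) = M *ᵥ a := by
    ext i; simp [mulVec, dotProduct, ha]
  have him : (fun i => ((M.map Complex.ofReal *ᵥ w) i).im) = M *ᵥ b := by
    ext i; simp [mulVec, dotProduct, hb]
  refine ⟨a ⬝ᵥ a + b ⬝ᵥ b, a ⬝ᵥ M *ᵥ a + b ⬝ᵥ M *ᵥ b,
    (M *ᵥ a) ⬝ᵥ (M *ᵥ a) + (M *ᵥ b) ⬝ᵥ (M *ᵥ b), ?_, ?_, ?_, ?_, ?_, ?_, ?_, ?_⟩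
  · rw [hdot, ← ha, ← hb, dotProduct_comm b a]; simp
  · rw [hdot, hre, him, ← ha, ← hb, hsymm a b, dotProduct_comm (M *ᵥ a) b]; simp
  · rw [hdot, hre, him, dotProduct_comm (M *ᵥ b) (M *ᵥ a)]; simp
  · exact add_nonneg (hself _) (hself _)
  · intro h
    have h1 : a ⬝ᵥ a = 0 := by
      linarith [hself a, hself b]
    have h2 : b ⬝ᵥ b = 0 := by linarith
    rw [dotProduct_self_eq_zero] at h1 h2
    ext i
    exact Complex.ext (congrFun h1 i) (congrFun h2 i)
  · linarith [hlow a, hlow b]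
  · linarith [hS a, hS b]
  · linarith [hsq a, hsq b]

/-- The scalar core: `s`, `q`, `S` stand for `|w|²`, `w*Mw`, `|Mw|²`, `α` for the mean of the
eigenvector scaled to 1 at `W`, and `m` for the reciprocal of the dimension. -/
theorem real_and_half_le_of_quadratic_relations {z α : ℂ} {s q S m θ r : ℝ} (hθ : 0 < θ)
    (hθr : θ ≤ r) (hm : 0 < m) (hm1 : m ≤ 1) (hs : 0 ≤ s) (hq : θ * s ≤ q) (hS : S ≤ r * q)
    (hsq : 0 ≤ S - 2 * θ * q + θ ^ 2 * s) (hs0 : s = 0 → α = m)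
    (h1 : (q : ℂ) = z * (s + m - star α))
    (h2 : (S : ℂ) = z * star z * (s + 1 + m - α - star α))
    (h3 : α * (z - r) = r * (1 - m)) :
    z.im = 0 ∧ θ / 2 ≤ z.re := by
  obtain ⟨a, b⟩ := z
  obtain ⟨p, e⟩ := α
  simp only [Complex.ext_iff, Complex.mul_re, Complex.mul_im, Complex.sub_re, Complex.sub_im,
    Complex.add_re, Complex.add_im, Complex.ofReal_re, Complex.ofReal_im, Complex.star_def,
    Complex.conj_re, Complex.conj_im, Complex.one_re, Complex.one_im] at h1 h2 h3 hs0 ⊢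
  obtain ⟨h1r, h1i⟩ := h1
  obtain ⟨h2r, -⟩ := h2
  obtain ⟨h3r, h3i⟩ := h3
  have hq0 : 0 ≤ q := le_trans (by positivity) hq
  have hb : b = 0 := by
    by_contra hb
    have hX : (a ^ 2 + b ^ 2) * (s + m - p) = q * a := by linear_combination -a * h1r - b * h1i
    have he : (a ^ 2 + b ^ 2) * e = -(q * b) := by linear_combination b * h1r - a * h1i
    have hp : (a ^ 2 + b ^ 2) * p = q * (a - r) := by
      apply mul_left_cancel₀ hb
      linear_combination (a ^ 2 + b ^ 2) * h3i - (a - r) * he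
    -- For non-real `z`, eliminating `α` leaves `S = |z|² + rq`, against `S ≤ rq`.
    have hSeq : S = a ^ 2 + b ^ 2 + q * r := by linear_combination h2r + hX - hp
    have : 0 < b ^ 2 := by positivity
    nlinarith [sq_nonneg a]
  refine ⟨hb, ?_⟩
  subst hb
  by_contra! ha
  have hra : 0 < r - a := by linarith
  have h1m : 0 ≤ 1 - m := by linarith
  have hp : p * (r - a) = -(r * (1 - m)) := by linarith
  have hq' : q = a * (s + m - p) := by linarith
  have hS' : S = a ^ 2 * (s + m - p + 1 - p) := by linarith
  have hp0 : p ≤ 0 := by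
    by_contra! h
    nlinarith [mul_pos h hra, mul_nonneg (hθ.le.trans hθr) h1m]
  rcases lt_trichotomy a 0 with h | h | h
  · nlinarith [mul_pos (neg_pos.2 h) (by linarith : 0 < s + m - p)]
  · subst h
    have hs' : s = 0 := by nlinarith
    have := (hs0 hs').1
    linarith
  · have hp1 : p ≤ -(1 - m) := by
      by_contra! hc
      nlinarith [mul_pos (sub_pos.2 hc) hra, mul_nonneg h.le h1m]
    -- Adding `(θ-a)(q-θs) ≥ 0` to `hsq` cancels `s`. With `hp1` this forces `a(2-m) ≥ θ`,
    -- contradicting `a < θ/2`.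
    have hkey : 0 ≤ a * (a - θ * m + (θ - a) * p) := by
      have := mul_nonneg (by linarith : 0 ≤ θ - a) (sub_nonneg.2 hq)
      rw [hS', hq'] at hsq
      rw [hq'] at this
      linarith
    have := nonneg_of_mul_nonneg_right hkey h
    nlinarith [mul_nonneg (by linarith : 0 ≤ θ - a) (sub_nonneg.2 hp1), mul_pos h hm]

open Matrix in
/-- Let `M` be a real symmetric matrix with constant row sums `r` and `0 < θ ≤ M ≤ r`. Replacing
a column of `M` with the row sums yields a matrix whose eigenvalues are real and at least
`θ / 2`. -/
theorem eigenvalue_updateCol_rowSum {n : Type*} [Fintype n] [DecidableEq n] {M : Matrix n n ℝ}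
    {θ r : ℝ} (hM : M.IsSymm) (hθ : 0 < θ)
    (hlow : ∀ x : n → ℝ, θ * (x ⬝ᵥ x) ≤ x ⬝ᵥ M *ᵥ x)
    (hupp : ∀ x : n → ℝ, x ⬝ᵥ M *ᵥ x ≤ r * (x ⬝ᵥ x)) (hrow : ∀ i, ∑ j, M i j = r)
    (W : n) {z : ℂ}
    (hz : Module.End.HasEigenvalue
      (toLin' ((M.updateCol W fun i => ∑ j, M i j).map Complex.ofReal)) z) :
    ∃ x : ℝ, z = x ∧ θ / 2 ≤ x := by
  set A : Matrix n n ℂ := M.map Complex.ofReal with hA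
  have hAT : Aᵀ = A := by rw [hA, ← transpose_map, hM.eq]
  have hθr : θ ≤ r := by
    have h := (hlow (Pi.single W 1)).trans (hupp (Pi.single W 1))
    simpa using h
  have hr : 0 < r := hθ.trans_le hθr
  obtain ⟨x, hx, hx0⟩ := hz.exists_hasEigenvector
  have hev : ∀ i, (A *ᵥ x) i + x W * (r - A i W) = z * x i := by
    intro i
    have h := congrFun (Module.End.mem_eigenspace_iff.1 hx) i
    rw [toLin'_apply, Pi.smul_apply, smul_eq_mul] at h
    rw [← h]
    have hcol : ((M.updateCol W fun i => ∑ j, M i j).map Complex.ofReal) =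
        A.updateCol W fun _ => (r : ℂ) := by
      ext i j
      by_cases hj : j = W <;> simp [hj, hA, hrow]
    rw [hcol]
    simp only [mulVec, dotProduct]
    rw [← Finset.add_sum_erase _ _ (Finset.mem_univ W),
      ← Finset.add_sum_erase _ (fun j => A.updateCol W (fun _ => (r : ℂ)) i j * x j)
        (Finset.mem_univ W)]
    have : ∑ j ∈ Finset.univ.erase W, A.updateCol W (fun _ => (r : ℂ)) i j * x j =
        ∑ j ∈ Finset.univ.erase W, A i j * x j :=
      Finset.sum_congr rfl fun j hj => by rw [updateCol_ne (Finset.ne_of_mem_erase hj)]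
    rw [this, updateCol_self]
    ring
  by_cases hxW : x W = 0
  · have hAx : A *ᵥ x = z • x := by
      ext i
      simpa [hxW] using hev i
    obtain ⟨s, q, S, hs, hq, -, hs0, hsx, hlow', -⟩ :=
      exists_quadratic_data hM hθ hr hlow hupp x
    rw [← hA, hAx, dotProduct_smul, hs, smul_eq_mul] at hq
    have hspos : 0 < s := lt_of_le_of_ne hs0 fun h => hx0 (hsx h.symm)
    have hz' : z = ((q / s : ℝ) : ℂ) := by
      rw [Complex.ofReal_div, eq_div_iff (by exact_mod_cast hspos.ne'), hq]
    refine ⟨q / s, hz', ?_⟩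
    have : θ ≤ q / s := by rwa [le_div_iff₀ hspos]
    linarith
  have hrowA : ∀ i, ∑ j, A i j = (r : ℂ) := fun i => by
    simp only [hA, map_apply, ← Complex.ofReal_sum, hrow]
  have hcolA : ∀ j, ∑ i, A i j = (r : ℂ) := fun j => by
    rw [← hrowA j]
    exact Finset.sum_congr rfl fun i _ => congrFun (congrFun hAT j) i
  have hsumA : ∀ y : n → ℂ, ∑ i, (A *ᵥ y) i = r * ∑ i, y i := fun y => by
    simp only [mulVec, dotProduct]
    rw [Finset.sum_comm, Finset.mul_sum]
    exact Finset.sum_congr rfl fun j _ => by rw [← Finset.sum_mul, hcolA]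
  set y : n → ℂ := (x W)⁻¹ • x with hy
  have hyW : y W = 1 := by simp [hy, hxW]
  have hevy : ∀ i, (A *ᵥ y) i = z * y i - (r - A i W) := fun i => by
    have := hev i
    simp only [hy, mulVec_smul, Pi.smul_apply, smul_eq_mul]
    field_simp
    linear_combination this
  have hNpos : 0 < Fintype.card n := Fintype.card_pos_iff.2 ⟨W⟩
  set m : ℝ := (Fintype.card n : ℝ)⁻¹ with hmdef
  have hmpos : 0 < m := by positivity
  have hm1 : m ≤ 1 := inv_le_one_of_one_le₀ (by exact_mod_cast hNpos)
  have hmN : (Fintype.card n : ℂ) * m = 1 := by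
    rw [hmdef]; push_cast; exact mul_inv_cancel₀ (by exact_mod_cast hNpos.ne')
  set α : ℂ := m * ∑ i, y i with hα
  have h3 : α * (z - r) = r * (1 - m) := by
    have h := hsumA y
    simp only [hevy, Finset.sum_sub_distrib, ← Finset.mul_sum, hcolA, Finset.sum_const,
      Finset.card_univ, nsmul_eq_mul] at h
    rw [hα]
    linear_combination (m : ℂ) * h + (r : ℂ) * hmN
  -- `d` and `w` are orthogonal to constants, so pairing `w` with `d` merely reads off the entry of
  -- `w` at `W`.
  set d : n → ℂ := fun i => (Pi.single W 1 : n → ℂ) i - m with hd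
  set w : n → ℂ := fun i => y i - α - d i with hw
  have hsum1 : ∑ i, (Pi.single W 1 : n → ℂ) i = 1 := by simp
  have hsumd : ∑ i, d i = 0 := by
    simp only [hd, Finset.sum_sub_distrib, hsum1, Finset.sum_const, Finset.card_univ,
      nsmul_eq_mul, hmN, sub_self]
  have hsumw : ∑ i, w i = 0 := by
    simp only [hw, Finset.sum_sub_distrib, hsumd, Finset.sum_const, Finset.card_univ,
      nsmul_eq_mul, hα]
    linear_combination -(∑ i, y i) * hmN
  have hwW : w W = m - α := by simp [hw, hd, hyW]
  have hAw : A *ᵥ w = z • (w + d) := by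
    have hdec : w = y - Pi.single W 1 - (fun _ => α - m) := by
      ext i; simp only [hw, hd, Pi.sub_apply]; ring
    ext i
    have hconst : (A *ᵥ fun _ => α - m) i = r * (α - m) := by
      simp only [mulVec, dotProduct, ← Finset.sum_mul, hrowA]
    rw [hdec, mulVec_sub, mulVec_sub, Pi.sub_apply, Pi.sub_apply, hconst, hevy, ← hdec]
    simp only [mulVec_single_one, col_apply, Pi.smul_apply, Pi.add_apply, smul_eq_mul, hw]
    linear_combination h3
  have hdot : ∀ v : n → ℂ, ∑ i, v i = 0 → star v ⬝ᵥ d = star (v W) := fun v hv => by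
    have : ∑ i, star (v i) = 0 := by rw [← star_sum, hv, star_zero]
    simp only [dotProduct, hd, mul_sub, Finset.sum_sub_distrib, Pi.star_apply,
      ← Finset.sum_mul, this, Pi.single_apply]
    simp
  have hwd : star w ⬝ᵥ d = m - star α := by
    rw [hdot w hsumw, hwW, star_sub]; simp
  have hdw : star d ⬝ᵥ w = m - α := by
    rw [star_dotProduct, hwd]; simp
  have hdd : star d ⬝ᵥ d = 1 - m := by
    rw [hdot d hsumd]; simp [hd]
  obtain ⟨s, q, S, hs, hq, hS, hs0, hsw, hlow', hSr, hsq⟩ :=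
    exists_quadratic_data hM hθ hr hlow hupp w
  rw [← hA, hAw] at hq hS
  have := real_and_half_le_of_quadratic_relations (z := z) (α := α) hθ hθr hmpos hm1 hs0 hlow'
    hSr hsq
    (fun h => by
      have h0 := congrFun (hsw h) W
      rw [hwW, Pi.zero_apply, sub_eq_zero] at h0
      exact h0.symm)
    (by
      rw [← hq, dotProduct_smul, dotProduct_add, hs, hwd, smul_eq_mul]; ring)
    (by
      rw [← hS, star_smul, smul_dotProduct, dotProduct_smul, star_add, add_dotProduct,
        dotProduct_add, dotProduct_add, hs, hwd, hdw, hdd, smul_eq_mul, smul_eq_mul]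
      ring)
    h3
  exact ⟨z.re, Complex.ext rfl this.1, this.2⟩

/-! ### Binomial identities and asymptotics. -/

/-- Vandermonde's identity in shifted form. -/
theorem choose_add_add_eq_sum (n l s : ℕ) {t : ℕ} (hst : s ≤ t) :
    (n + s).choose (l + s) = ∑ j ∈ Finset.range (t + 1), n.choose (l + j) * s.choose j := by
  induction s generalizing l t with
  | zero =>
    rw [Finset.sum_eq_single 0] <;> simp +contextual [Nat.choose_eq_zero_of_lt, Nat.pos_iff_ne_zero]
  | succ s ih =>
    obtain ⟨t, rfl⟩ : ∃ u, t = u + 1 := ⟨t - 1, by omega⟩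
    rw [← add_assoc, ← add_assoc, Nat.choose_succ_succ, ih l (by omega : s ≤ t + 1),
      show (l + s).succ = l + 1 + s by omega, ih (l + 1) (by omega : s ≤ t),
      Finset.sum_range_succ' _ (t + 1), Finset.sum_range_succ' _ (t + 1)]
    simp only [Nat.choose_succ_succ, mul_add, Finset.sum_add_distrib, Nat.choose_zero_right,
      add_zero]
    have : ∀ j, n.choose (l + 1 + j) * s.choose j = n.choose (l + (j + 1)) * s.choose j :=
      fun j => by rw [add_right_comm, add_assoc]
    simp only [this]
    ring

theorem choose_lt_choose_succ_of_two_mul_lt {n k : ℕ} (h : 2 * k + 1 < n) :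
    n.choose k < n.choose (k + 1) := by
  have h1 := Nat.choose_succ_right_eq n k
  have h2 : 0 < n.choose k := Nat.choose_pos (by omega)
  by_contra! h3
  have : n.choose k * (k + 1) < n.choose k * (n - k) :=
    Nat.mul_lt_mul_of_pos_left (by omega) h2
  nlinarith

theorem isEquivalent_choose_sub (m a : ℕ) :
    (fun v : ℕ => ((v - a).choose m : ℝ)) ~[atTop] fun v : ℕ => (v : ℝ) ^ m / m.factorial := by
  have h1 := (isEquivalent_choose m).comp_tendsto (tendsto_sub_atTop_nat a)
  refine h1.trans ?_
  have h2 : (fun v : ℕ => ((v - a : ℕ) : ℝ)) ~[atTop] fun v : ℕ => (v : ℝ) := by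
    have h3 : (fun _ : ℕ => -(a : ℝ)) =o[atTop] fun v : ℕ => (v : ℝ) :=
      isLittleO_const_left.2 (Or.inr (tendsto_norm_atTop_atTop.comp tendsto_natCast_atTop_atTop))
    refine h3.congr' ?_ EventuallyEq.rfl
    filter_upwards [eventually_ge_atTop a] with v hv
    simp [Nat.cast_sub hv]
  exact (h2.pow m).div IsEquivalent.refl

theorem choose_sub_sub_choose_sub_isLittleO (m a b : ℕ) :
    (fun v : ℕ => ((v - a).choose m : ℝ) - ((v - b).choose m : ℝ)) =o[atTop]
      fun v : ℕ => (v : ℝ) ^ m := by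
  have h := ((isEquivalent_choose_sub m a).trans (isEquivalent_choose_sub m b).symm).isLittleO
  have hO : (fun v : ℕ => ((v - b).choose m : ℝ)) =O[atTop] fun v : ℕ => (v : ℝ) ^ m := by
    refine (isEquivalent_choose_sub m b).isBigO.trans ?_
    simp_rw [div_eq_mul_inv, mul_comm _ (_⁻¹)]
    exact (isBigO_refl _ _).const_mul_left _
  exact h.trans_isBigO hO

/-! ### Inclusion sums and the spectrum of the coverage matrix. -/

section Coverage

variable {V : Type*} [Fintype V] [DecidableEq V] {k t : ℕ}

/-- The sum of a function on `t`-subsets over the supersets of `J`. -/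
def supersetSum (x : {T : Finset V // T.card = t} → ℝ) (J : Finset V) : ℝ :=
  ∑ T, if J ⊆ T.1 then x T else 0

theorem coverageMatrix_apply_eq_sum (hk : 2 * t ≤ k) (hv : k + t ≤ Fintype.card V)
    (T U : {T : Finset V // T.card = t}) :
    coverageMatrix V k t T U = ∑ j ∈ Finset.range (t + 1),
      ((Fintype.card V - 2 * t).choose (k - 2 * t + j) : ℝ) *
        ((T.1 ∩ U.1).card.choose j : ℝ) := by
  have h := Finset.card_sdiff_add_card_inter T.1 U.1
  rw [T.2] at h
  have hs : (T.1 ∩ U.1).card ≤ t := by omega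
  have h2 := choose_add_add_eq_sum (Fintype.card V - 2 * t) (k - 2 * t) _ hs
  simp only [coverageMatrix, Matrix.of_apply, xi]
  rw [show Fintype.card V - t - (T.1 \ U.1).card =
      Fintype.card V - 2 * t + (T.1 ∩ U.1).card by omega,
    show k - t - (T.1 \ U.1).card = k - 2 * t + (T.1 ∩ U.1).card by omega, h2]
  push_cast
  rfl

theorem coverageMatrix_mulVec_apply (hk : 2 * t ≤ k) (hv : k + t ≤ Fintype.card V)
    (x : {T : Finset V // T.card = t} → ℝ) (T : {T : Finset V // T.card = t}) :
    (coverageMatrix V k t).mulVec x T =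
      ((Fintype.card V - 2 * t).choose (k - t) : ℝ) * x T +
      ∑ j ∈ Finset.range t, ((Fintype.card V - 2 * t).choose (k - 2 * t + j) : ℝ) *
        ∑ J ∈ Finset.powersetCard j Finset.univ, if J ⊆ T.1 then supersetSum x J else 0 := by
  have hchoose (j : ℕ) (U : {T : Finset V // T.card = t}) :
      ((T.1 ∩ U.1).card.choose j : ℝ) =
        ∑ J ∈ Finset.powersetCard j Finset.univ, if J ⊆ T.1 ∧ J ⊆ U.1 then (1 : ℝ) else 0 := by
    rw [← Finset.card_powersetCard, Finset.sum_boole]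
    congr 2
    ext J
    simp [Finset.mem_powersetCard, Finset.subset_inter_iff, and_comm]
  have hinner (j : ℕ) : ∑ U, ((T.1 ∩ U.1).card.choose j : ℝ) * x U =
      ∑ J ∈ Finset.powersetCard j Finset.univ, if J ⊆ T.1 then supersetSum x J else 0 := by
    simp_rw [hchoose, Finset.sum_mul]
    rw [Finset.sum_comm]
    refine Finset.sum_congr rfl fun J _ => ?_
    by_cases hJ : J ⊆ T.1 <;> simp [hJ, supersetSum]
  -- Two `t`-sets meet in `t` points only if they coincide, so the top term is the identity.
  have htop : ∑ U, ((T.1 ∩ U.1).card.choose t : ℝ) * x U = x T := by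
    rw [Finset.sum_eq_single T]
    · simp [T.2]
    · intro U _ hU
      rw [Nat.choose_eq_zero_of_lt]
      · simp
      · by_contra! h
        refine hU (Subtype.ext ?_)
        have h1 : T.1 ∩ U.1 = T.1 :=
          Finset.eq_of_subset_of_card_le Finset.inter_subset_left (by rwa [T.2])
        have h2 : T.1 ∩ U.1 = U.1 :=
          Finset.eq_of_subset_of_card_le Finset.inter_subset_right (by rwa [U.2])
        rw [← h1, h2]
    · simp
  have hexp : (coverageMatrix V k t).mulVec x T = ∑ j ∈ Finset.range (t + 1),
      ((Fintype.card V - 2 * t).choose (k - 2 * t + j) : ℝ) *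
        ∑ U, ((T.1 ∩ U.1).card.choose j : ℝ) * x U := by
    simp_rw [Matrix.mulVec, dotProduct, coverageMatrix_apply_eq_sum hk hv, Finset.sum_mul,
      Finset.mul_sum]
    rw [Finset.sum_comm]
    simp_rw [mul_assoc]
  rw [hexp, Finset.sum_range_succ, htop, add_comm, show k - 2 * t + t = k - t by omega]
  simp_rw [hinner]

theorem coverageMatrix_isSymm : (coverageMatrix V k t).IsSymm := by
  ext T U
  have h : (U.1 \ T.1).card = (T.1 \ U.1).card := by
    have h1 := Finset.card_sdiff_add_card_inter T.1 U.1
    have h2 := Finset.card_sdiff_add_card_inter U.1 T.1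
    rw [Finset.inter_comm, T.2.trans U.2.symm] at h1
    omega
  simp [coverageMatrix, h]

theorem le_dotProduct_coverageMatrix_mulVec (hk : 2 * t ≤ k) (hv : k + t ≤ Fintype.card V)
    (x : {T : Finset V // T.card = t} → ℝ) :
    ((Fintype.card V - 2 * t).choose (k - t) : ℝ) * dotProduct x x ≤
      dotProduct x ((coverageMatrix V k t).mulVec x) := by
  have h : dotProduct x ((coverageMatrix V k t).mulVec x) =
      ((Fintype.card V - 2 * t).choose (k - t) : ℝ) * dotProduct x x +
      ∑ j ∈ Finset.range t, ((Fintype.card V - 2 * t).choose (k - 2 * t + j) : ℝ) *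
        ∑ J ∈ Finset.powersetCard j Finset.univ, supersetSum x J ^ 2 := by
    simp_rw [dotProduct, coverageMatrix_mulVec_apply hk hv, mul_add, Finset.sum_add_distrib,
      Finset.mul_sum]
    congr 1
    · exact Finset.sum_congr rfl fun T _ => by ring
    · rw [Finset.sum_comm]
      refine Finset.sum_congr rfl fun j _ => ?_
      rw [Finset.sum_comm]
      refine Finset.sum_congr rfl fun J _ => ?_
      rw [sq, ← mul_assoc]
      conv_rhs =>
        arg 2
        rw [supersetSum]
      rw [Finset.mul_sum]
      refine Finset.sum_congr rfl fun T _ => ?_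
      split_ifs <;> ring
  rw [h]
  have : 0 ≤ ∑ j ∈ Finset.range t, ((Fintype.card V - 2 * t).choose (k - 2 * t + j) : ℝ) *
      ∑ J ∈ Finset.powersetCard j Finset.univ, supersetSum x J ^ 2 := by positivity
  linarith

/-- A symmetric nonnegative matrix with constant row sums `r` is at most `r` as a quadratic
form. -/
theorem dotProduct_mulVec_le_of_rowSum {n : Type*} [Fintype n] {M : Matrix n n ℝ} {r : ℝ}
    (hM : M.IsSymm) (h0 : ∀ i j, 0 ≤ M i j) (hrow : ∀ i, ∑ j, M i j = r) (x : n → ℝ) :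
    dotProduct x (M.mulVec x) ≤ r * dotProduct x x := by
  have h1 : ∑ i, ∑ j, M i j * x i ^ 2 = r * dotProduct x x := by
    simp_rw [← Finset.sum_mul, hrow, dotProduct, Finset.mul_sum, sq]
  have h2 : ∑ i, ∑ j, M i j * x j ^ 2 = r * dotProduct x x := by
    rw [Finset.sum_comm, ← h1]
    exact Finset.sum_congr rfl fun i _ => Finset.sum_congr rfl fun j _ => by rw [hM.apply]
  have h3 : dotProduct x (M.mulVec x) = ∑ i, ∑ j, M i j * (x i * x j) := by
    simp_rw [dotProduct, Matrix.mulVec, dotProduct, Finset.mul_sum]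
    exact Finset.sum_congr rfl fun i _ => Finset.sum_congr rfl fun j _ => by ring
  have h4 : 0 ≤ ∑ i, ∑ j, M i j * (x i - x j) ^ 2 :=
    Finset.sum_nonneg fun i _ => Finset.sum_nonneg fun j _ => mul_nonneg (h0 i j) (sq_nonneg _)
  have h5 : ∑ i, ∑ j, M i j * (x i - x j) ^ 2 = (∑ i, ∑ j, M i j * x i ^ 2) +
      (∑ i, ∑ j, M i j * x j ^ 2) - 2 * ∑ i, ∑ j, M i j * (x i * x j) := by
    simp_rw [Finset.mul_sum, ← Finset.sum_add_distrib, ← Finset.sum_sub_distrib]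
    exact Finset.sum_congr rfl fun i _ => Finset.sum_congr rfl fun j _ => by ring
  linarith

/-- A permutation of `V` carrying `T` to `T'` permutes the `t`-subsets and preserves the entries. -/
theorem coverageMatrix_rowSum_eq (T T' : {T : Finset V // T.card = t}) :
    ∑ U, coverageMatrix V k t T U = ∑ U, coverageMatrix V k t T' U := by
  have hcard : Fintype.card {a // a ∈ T.1} = Fintype.card {a // a ∈ T'.1} := by
    simp [T.2, T'.2]
  let e := Fintype.equivOfCardEq hcard
  let σ : Equiv.Perm V := e.extendSubtype
  have hσ : T.1.map σ.toEmbedding = T'.1 := by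
    apply Finset.eq_of_subset_of_card_le
    · intro a ha
      obtain ⟨b, hb, rfl⟩ := Finset.mem_map.1 ha
      exact e.extendSubtype_mem b hb
    · simp [T.2, T'.2]
  let E : {T : Finset V // T.card = t} ≃ {T : Finset V // T.card = t} :=
    σ.finsetCongr.subtypeEquiv fun U => by simp
  refine Fintype.sum_equiv E _ _ fun U => ?_
  have : T'.1 \ (E U).1 = (T.1 \ U.1).map σ.toEmbedding := by
    rw [Finset.map_sdiff, hσ]
    simp [E]
  simp [coverageMatrix, this]

/-- There are fewer `(t-1)`-subsets than `t`-subsets, so the inclusion map has a kernel; vanishing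
passes to smaller `J` by double counting. -/
theorem exists_ne_zero_supersetSum_eq_zero (ht : 1 ≤ t) (hv : 2 * t ≤ Fintype.card V) :
    ∃ x : {T : Finset V // T.card = t} → ℝ, x ≠ 0 ∧
      ∀ J : Finset V, J.card < t → supersetSum x J = 0 := by
  obtain ⟨s, rfl⟩ : ∃ s, t = s + 1 := ⟨t - 1, by omega⟩
  let f : ({T : Finset V // T.card = s + 1} → ℝ) →ₗ[ℝ] ({K : Finset V // K.card = s} → ℝ) :=
    Matrix.toLin' (Matrix.of fun K T => if K.1 ⊆ T.1 then (1 : ℝ) else 0)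
  have hf : LinearMap.ker f ≠ ⊥ := by
    apply LinearMap.ker_ne_bot_of_finrank_lt
    simp only [Module.finrank_fintype_fun_eq_card, Fintype.card_finset_len]
    exact choose_lt_choose_succ_of_two_mul_lt (by omega)
  obtain ⟨x, hx, hx0⟩ := Submodule.exists_mem_ne_zero_of_ne_bot hf
  have htop (K : Finset V) (hK : K.card = s) : supersetSum x K = 0 := by
    have h := congrFun (LinearMap.mem_ker.1 hx) ⟨K, hK⟩
    simpa [f, Matrix.mulVec, dotProduct, supersetSum] using h
  refine ⟨x, hx0, fun J hJ => ?_⟩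
  -- The sets `K` between `J` and `T` arise by deleting one point of `T \ J`, so this count is
  -- nonzero.
  have hcount (T : {T : Finset V // T.card = s + 1}) (hJT : J ⊆ T.1) :
      ((Finset.powersetCard s Finset.univ).filter fun K => J ⊆ K ∧ K ⊆ T.1).card =
        s + 1 - J.card := by
    have h : (Finset.powersetCard s Finset.univ).filter (fun K => J ⊆ K ∧ K ⊆ T.1) =
        (T.1 \ J).image fun a => T.1.erase a := by
      ext K
      simp only [Finset.mem_filter, Finset.mem_powersetCard, Finset.subset_univ, true_and,
        Finset.mem_image, Finset.mem_sdiff]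
      constructor
      · rintro ⟨hK, hJK, hKT⟩
        have h1 : (T.1 \ K).card = 1 := by
          rw [Finset.card_sdiff_of_subset hKT, T.2, hK]; omega
        obtain ⟨a, ha⟩ := Finset.card_eq_one.1 h1
        have haT : a ∈ T.1 \ K := ha ▸ Finset.mem_singleton_self a
        rw [Finset.mem_sdiff] at haT
        refine ⟨a, ⟨haT.1, fun h => haT.2 (hJK h)⟩, ?_⟩
        rw [← Finset.sdiff_singleton_eq_erase, ← ha, Finset.sdiff_sdiff_eq_self hKT]
      · rintro ⟨a, ⟨haT, haJ⟩, rfl⟩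
        refine ⟨?_, Finset.subset_erase.2 ⟨hJT, haJ⟩, Finset.erase_subset _ _⟩
        rw [Finset.card_erase_of_mem haT, T.2]; rfl
    rw [h, Finset.card_image_of_injOn, Finset.card_sdiff_of_subset hJT, T.2]
    intro a ha b hb hab
    by_contra hne
    have : a ∈ T.1.erase b :=
      Finset.mem_erase.2 ⟨hne, (Finset.mem_sdiff.1 (Finset.mem_coe.1 ha)).1⟩
    rw [← show T.1.erase a = T.1.erase b from hab] at this
    exact Finset.notMem_erase a _ this
  have hsum : ((s + 1 - J.card : ℕ) : ℝ) * supersetSum x J =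
      ∑ K ∈ (Finset.powersetCard s Finset.univ).filter (J ⊆ ·), supersetSum x K := by
    simp_rw [supersetSum]
    rw [Finset.sum_comm, Finset.mul_sum]
    refine Finset.sum_congr rfl fun T _ => ?_
    rw [← Finset.sum_filter, Finset.filter_filter, Finset.sum_const, nsmul_eq_mul]
    split_ifs with hJT
    · rw [hcount T hJT]
    · rw [Finset.filter_false_of_mem]
      · simp
      · exact fun K _ h => hJT (h.1.trans h.2)
  rw [Finset.sum_eq_zero fun K hK => htop K
    (Finset.mem_powersetCard.1 (Finset.mem_filter.1 hK).1).2] at hsum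
  refine (mul_eq_zero.1 hsum).resolve_left ?_
  exact_mod_cast (by omega : s + 1 - J.card ≠ 0)

theorem isLeast_eigenvalues_coverageMatrix (ht : 1 ≤ t) (hk : 2 * t ≤ k)
    (hv : k + t ≤ Fintype.card V) :
    IsLeast {μ : ℝ | Module.End.HasEigenvalue (Matrix.toLin' (coverageMatrix V k t)) μ}
      ((Fintype.card V - 2 * t).choose (k - t) : ℝ) := by
  constructor
  · obtain ⟨x, hx0, hx⟩ := exists_ne_zero_supersetSum_eq_zero (V := V) ht (by omega)
    refine Module.End.hasEigenvalue_of_hasEigenvector (x := x)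
      ⟨Module.End.mem_eigenspace_iff.2 ?_, hx0⟩
    ext T
    rw [Matrix.toLin'_apply, coverageMatrix_mulVec_apply hk hv, Pi.smul_apply, smul_eq_mul,
      add_eq_left]
    refine Finset.sum_eq_zero fun j hj => ?_
    rw [Finset.sum_eq_zero, mul_zero]
    intro J hJ
    rw [hx J (by rw [(Finset.mem_powersetCard.1 hJ).2]; exact Finset.mem_range.1 hj), ite_self]
  · intro μ hμ
    obtain ⟨x, hx, hx0⟩ := Module.End.HasEigenvalue.exists_hasEigenvector hμ
    have hx' : (coverageMatrix V k t).mulVec x = μ • x := by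
      simpa using Module.End.mem_eigenspace_iff.1 hx
    have h := le_dotProduct_coverageMatrix_mulVec hk hv x
    rw [hx', dotProduct_smul, smul_eq_mul] at h
    have hpos : 0 < dotProduct x x :=
      lt_of_le_of_ne (Finset.sum_nonneg fun i _ => mul_self_nonneg (x i))
        fun h => hx0 (dotProduct_self_eq_zero.1 h.symm)
    exact le_of_mul_le_mul_right h hpos

end Coverage

theorem theorem2 (k t : ℕ) (ht : 1 ≤ t) (hk : 2 * t ≤ k) :
    ∃ θ : ℕ → ℝ,
      ((fun v : ℕ => θ v - ((v - t).choose (k - t) : ℝ)) =o[atTop]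
        fun v : ℕ => (v : ℝ) ^ (k - t)) ∧
      ∃ v₀ : ℕ, ∀ (V : Type*) [Fintype V] [DecidableEq V], v₀ ≤ Fintype.card V →
        IsLeast {μ : ℝ | Module.End.HasEigenvalue (Matrix.toLin' (coverageMatrix V k t)) μ}
          (θ (Fintype.card V)) ∧
        ∀ (W : {T : Finset V // T.card = t}) (z : ℂ),
          Module.End.HasEigenvalue
            (Matrix.toLin' ((coverageMatrixReplaced V k t W).map Complex.ofReal)) z →
          ∃ x : ℝ, z = (x : ℂ) ∧ θ (Fintype.card V) / 2 ≤ x := by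
  -- The threshold `k + t` is where `k - t ≤ v - 2t`, making `θ` positive.
  refine ⟨fun v => ((v - 2 * t).choose (k - t) : ℝ),
    choose_sub_sub_choose_sub_isLittleO (k - t) (2 * t) t, k + t, fun V _ _ hv =>
    ⟨isLeast_eigenvalues_coverageMatrix ht hk hv, fun W z hz => ?_⟩⟩
  have hrow (T : {T : Finset V // T.card = t}) :
      ∑ U, coverageMatrix V k t T U = ∑ U, coverageMatrix V k t W U :=
    coverageMatrix_rowSum_eq T W
  exact eigenvalue_updateCol_rowSum coverageMatrix_isSymm
    (Nat.cast_pos.2 (Nat.choose_pos (by omega)))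
    (le_dotProduct_coverageMatrix_mulVec hk hv)
    (dotProduct_mulVec_le_of_rowSum coverageMatrix_isSymm (fun _ _ => Nat.cast_nonneg _) hrow)
    hrow W hz
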